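/- All topological spaces are Hausdorff and completely regular. A *retractional skeleton* in a countably compact space $X$ is a family $\{r_s\}_{s\in\Gamma}$ of continuous retractions $r_s:X\to X$, indexed by a (nonempty) up-directed partially ordered set $\Gamma$, such that (i) $r_s[X]$ is compact and metrizable for each $s\in\Gamma$; (ii) if $s\le t$ in $\Gamma$, then $r_s=r_t\circ r_s=r_s\circ r_t$; (iii) if $s_0\le s_1\le\cdots$ in $\Gamma$, then $t=\sup_n s_n$ exists in $\Gamma$ and $r_t(x)=\lim_{n\to\infty} r_{s_n}(x)$ for every $x\in X$; (iv) $x=\lim_{s\in\Gamma} r_s(x)$ for every $x\in X$. A countably compact space $X$ is *non-commutative Corson* if it has a retractional skeleton that is full, i.e. $X=\bigcup_{s\in\Gamma} r_s[X]$; it is *weakly non-commutative Corson* if it is the image of a non-commutative Corson countably compact space under a continuous surjection. A compact space $K$ has *property $(M)$* if the support of every Radon probability measure on $K$ is a separable space. **Theorem.** Let $K$ be a weakly non-commutative Corson compact space with property $(M)$. Then the closed unit ball $B_{C(K)^*}$ of the dual of the Banach space $C(K)$ (with the supremum norm), endowed with the weak$^*$ topology, is a weakly non-commutative Corson compact space.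 This holds both for $C(K)=C(K,\mathbb{R})$ and for $C(K)=C(K,\mathbb{C})$. -/

import Mathlib

open Set Filter Topology MeasureTheory

universe u

/-- The family of self-maps `r s`, indexed by a nonempty up-directed partially ordered set, is a
retractional skeleton in the topological space `X`. -/
structure IsRetractionalSkeleton {X : Type*} [TopologicalSpace X] {Γ : Type*} [PartialOrder Γ]
    (r : Γ → X → X) : Prop where
  index_nonempty : Nonempty Γ
  index_directed : IsDirected Γ (· ≤ ·)
  continuous : ∀ s, Continuous (r s)
  retraction : ∀ s, r s ∘ r s = r s
  isCompact_range : ∀ s, IsCompact (range (r s))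
  metrizable_range : ∀ s, TopologicalSpace.MetrizableSpace (range (r s))
  comp_of_le : ∀ s t, s ≤ t → r s = r t ∘ r s ∧ r s = r s ∘ r t
  exists_sup : ∀ s : ℕ → Γ, Monotone s →
    ∃ t, IsLUB (range s) t ∧ ∀ x, Tendsto (fun n => r (s n) x) atTop (𝓝 (r t x))
  tendsto_self : ∀ x, Tendsto (fun s => r s x) atTop (𝓝 x)

/-- The set induced by a family of retractions: the union of their ranges. -/
def inducedSet {X Γ : Type*} (r : Γ → X → X) : Set X :=
  ⋃ s, range (r s)

/-- A non-commutative Corson countably compact space: a (completely regular Hausdorff) countably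
compact space with a full retractional skeleton. -/
structure IsNoncommCorson (X : Type u) [TopologicalSpace X] : Prop where
  t35 : T35Space X
  countablyCompact : CountablyCompactSpace X
  exists_full_skeleton : ∃ (Γ : Type u) (_ : PartialOrder Γ) (r : Γ → X → X),
    IsRetractionalSkeleton r ∧ inducedSet r = univ

/-- A weakly non-commutative Corson countably compact space: a (completely regular Hausdorff)
countably compact space that is a continuous image of a non-commutative Corson countably compact
space. -/
structure IsWeaklyNoncommCorson (X : Type u) [TopologicalSpace X] : Prop where
  t35 : T35Space X
  countablyCompact : CountablyCompactSpace X
  exists_surjection : ∃ (Y : Type u) (_ : TopologicalSpace Y), IsNoncommCorson Y ∧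
    ∃ f : Y → X, Continuous f ∧ Function.Surjective f

/-- A weakly non-commutative Corson compact space. -/
def IsWeaklyNoncommCorsonCompact (X : Type u) [TopologicalSpace X] : Prop :=
  CompactSpace X ∧ IsWeaklyNoncommCorson X

/-- Property (M): every Radon (regular Borel) probability measure on the compact space `K` has a
support which is separable in its subspace topology. -/
def HasPropertyM (K : Type u) [TopologicalSpace K] : Prop :=
  ∀ [MeasurableSpace K] [BorelSpace K] (μ : Measure K) [IsProbabilityMeasure μ] [μ.Regular],
    TopologicalSpace.SeparableSpace μ.support

/-- The closed unit ball of the dual of `C(K, 𝕜)`, a subset of the dual with the weak* topology;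
the norm is the operator norm. -/
def dualUnitBall (𝕜 : Type) [RCLike 𝕜] (K : Type u) [TopologicalSpace K] [CompactSpace K] :
    Set (WeakDual 𝕜 C(K, 𝕜)) :=
  {φ | ‖WeakDual.toStrongDual φ‖ ≤ 1}

/-!
Let `f : Y → K` be a continuous surjection from a countably compact space `Y` with a full
retractional skeleton `r`. Composition with the retractions, `P s g = g ∘ r s`, gives norm-one
projections on the Banach space of bounded continuous functions on `Y`, and the proof transports
the skeleton to functionals through their adjoints; no measures on `Y` are needed.

* Pointwise convergence of `r (s n)` to `r t` along an increasing sequence implies norm convergence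
  of `P (s n) g` to `P t g` (`IsRetractionalSkeleton.tendsto_compContinuous`). Hence the adjoints of
  the `P s` satisfy the axioms of a retractional skeleton on the functionals `φ` of norm at most one
  with `φ ∘ P s = φ` for some `s`. The skeleton is full by construction, and the space is countably
  compact since countably many of its points lie in the compact range of a single adjoint
  (`IsContractiveProjectionalSkeleton.isNoncommCorson_invariantBall`).

* Restricting functionals along `f` maps this space onto the dual unit ball of `C(K, 𝕜)`. Given `ν`
  in that ball, a positive functional dominating `ν` is represented by a Radon probability measure;
  by property (M) its support has a countable dense subset `C`, so that `‖ν g‖ ≤ sup_C ‖g‖`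
  (`HasPropertyM.exists_countable_norm_le`). Fullness of the skeleton gives an index `s` with
  `C ⊆ f (range (r s))`, so `‖ν g‖ ≤ ‖g ∘ f ∘ r s‖`, and the Hahn–Banach theorem yields `ψ` of norm
  at most one with `ν g = ψ (g ∘ f ∘ r s)`. The functional `ψ ∘ P s` is a preimage of `ν`.
-/

open scoped CompactlySupported BoundedContinuousFunction

/-! ### Functionals on `C(K, 𝕜)` and property (M) -/

section Domination

variable {K : Type*} [TopologicalSpace K] [CompactSpace K] {𝕜 : Type*} [RCLike 𝕜]

/-- Every functional `ν` of norm at most one on `C(K, 𝕜)` is dominated by a state of `C(K, ℝ)`.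
This is the M. Riesz extension theorem for the cone of pairs `(h, k)` with `‖h‖ ≤ k` pointwise,
applied to `(h, c) ↦ c - re ν(h)` on the pairs whose second entry is a constant function. -/
theorem exists_positive_functional_dominating [Nonempty K] (ν : StrongDual 𝕜 C(K, 𝕜))
    (hν : ‖ν‖ ≤ 1) :
    ∃ Λ : C(K, ℝ) →ₗ[ℝ] ℝ, Λ 1 = 1 ∧ (∀ k, 0 ≤ k → 0 ≤ Λ k) ∧
      ∀ (h : C(K, 𝕜)) (k : C(K, ℝ)), (∀ x, ‖h x‖ ≤ k x) → ‖ν h‖ ≤ Λ k := by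
  let s : PointedCone ℝ (C(K, 𝕜) × C(K, ℝ)) :=
    { carrier := {p | ∀ x, ‖p.1 x‖ ≤ p.2 x}
      zero_mem' := by simp
      add_mem' := fun {p q} hp hq x => (norm_add_le _ _).trans (add_le_add (hp x) (hq x))
      smul_mem' := fun c p hp x => by
        have h1 : ((c • p).1 x) = (c : ℝ) • p.1 x := rfl
        have h2 : ((c • p).2 x) = (c : ℝ) * p.2 x := rfl
        rw [h1, h2, norm_smul, Real.norm_of_nonneg c.2]
        exact mul_le_mul_of_nonneg_left (hp x) c.2 }
  let ρ : C(K, 𝕜) →ₗ[ℝ] ℝ := RCLike.reLm ∘ₗ (ν.toLinearMap.restrictScalars ℝ)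
  have hρ : ∀ h, ρ h = RCLike.re (ν h) := fun _ => rfl
  have hρle : ∀ h, ρ h ≤ ‖h‖ := fun h =>
    (RCLike.re_le_norm _).trans ((ν.le_opNorm h).trans (mul_le_of_le_one_left (norm_nonneg _) hν))
  have h10 : (1 : C(K, ℝ)) ≠ 0 := one_ne_zero
  let f : (C(K, 𝕜) × C(K, ℝ)) →ₗ.[ℝ] ℝ :=
    ((-ρ).toPMap ⊤).coprod (LinearPMap.mkSpanSingleton (K := ℝ) (1 : C(K, ℝ)) (1 : ℝ) h10)
  have hmem : ∀ (h : C(K, 𝕜)) (c : ℝ), (h, c • (1 : C(K, ℝ))) ∈ f.domain := fun h c =>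
    ⟨trivial, Submodule.mem_span_singleton.2 ⟨c, rfl⟩⟩
  have hf : ∀ (h : C(K, 𝕜)) (c : ℝ), f ⟨(h, c • 1), hmem h c⟩ = c - ρ h := by
    intro h c
    have hspan : LinearPMap.mkSpanSingleton (K := ℝ) (1 : C(K, ℝ)) (1 : ℝ) h10
      ⟨c • 1, (hmem h c).2⟩ = c • 1 := LinearPMap.mkSpanSingleton'_apply _ _ _ c _
    calc f ⟨(h, c • 1), hmem h c⟩ = -ρ h + c • 1 := congrArg (-ρ h + ·) hspan
      _ = c - ρ h := by simp [sub_eq_neg_add]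
  obtain ⟨g, hgf, hgs⟩ := riesz_extension s f
    (by
      rintro ⟨⟨h, k⟩, hk⟩ hs
      obtain ⟨c, rfl⟩ := Submodule.mem_span_singleton.1 hk.2
      rw [hf, sub_nonneg]
      refine (hρle h).trans ?_
      have hc : ∀ x, ‖h x‖ ≤ c := fun x => by simpa using hs x
      exact (ContinuousMap.norm_le _ ((norm_nonneg _).trans (hc (Classical.arbitrary K)))).2 hc)
    (by
      rintro ⟨h, k⟩
      refine ⟨⟨(-h, ‖k‖ • 1), hmem _ _⟩, fun x => ?_⟩
      have := neg_le_of_abs_le (k.norm_coe_le_norm x)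
      simp
      linarith)
  have hg1 : ∀ h c, g (h, c • 1) = c - ρ h := fun h c => (hgf ⟨_, hmem h c⟩).trans (hf h c)
  refine ⟨g ∘ₗ LinearMap.inr ℝ _ _, by simpa using hg1 0 1, fun k hk => hgs _ fun x => ?_, ?_⟩
  · simpa using hk x
  · intro h k hk
    have key : ∀ h : C(K, 𝕜), (∀ x, ‖h x‖ ≤ k x) → ρ h ≤ g (0, k) := by
      intro h hk
      have h1 := hgs (h, k) hk
      have h2 : g (h, k) = g (h, (0 : ℝ) • 1) + g (0, k) := by rw [← map_add]; simp
      rw [h2, hg1] at h1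
      linarith
    -- Rotating `h` by a unimodular scalar turns `re ν(h)` into `‖ν h‖`.
    obtain ⟨c, hc, hcν⟩ := RCLike.exists_norm_eq_mul_self (ν h)
    have h1 : ρ (c • h) = ‖ν h‖ := by
      rw [hρ, map_smul, smul_eq_mul, ← hcν, RCLike.ofReal_re]
    rw [← h1]
    exact key _ fun x => by simpa [norm_smul, hc] using hk x

/-- Under property (M), each functional in the dual unit ball of `C(K, 𝕜)` is controlled by the
values on a countable set, a dense subset of the support of a dominating probability measure. -/
theorem HasPropertyM.exists_countable_norm_le {K : Type u} [TopologicalSpace K] [CompactSpace K]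
    [T2Space K] (hM : HasPropertyM K) (ν : StrongDual 𝕜 C(K, 𝕜)) (hν : ‖ν‖ ≤ 1) :
    ∃ C : Set K, C.Countable ∧
      ∀ (g : C(K, 𝕜)) (c : ℝ), 0 ≤ c → (∀ x ∈ C, ‖g x‖ ≤ c) → ‖ν g‖ ≤ c := by
  rcases isEmpty_or_nonempty K with hK | hK
  · refine ⟨∅, countable_empty, fun g c hc _ => ?_⟩
    rw [Subsingleton.elim g 0, map_zero, norm_zero]
    exact hc
  obtain ⟨Λ, hΛ1, hΛ, hνΛ⟩ := exists_positive_functional_dominating ν hν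
  borelize K
  -- The representation theorem is stated for compactly supported functions; here these are all
  -- continuous functions.
  let Λ' : C_c(K, ℝ) →ₚ[ℝ] ℝ := PositiveLinearMap.mk₀
    { toFun := fun f => Λ f.toContinuousMap
      map_add' := fun f g => Λ.map_add f.toContinuousMap g.toContinuousMap
      map_smul' := fun c f => Λ.map_smul c f.toContinuousMap } fun f hf => hΛ _ hf
  let μ := RealRMK.rieszMeasure Λ'
  have hμ : ∀ k : C(K, ℝ), ∫ x, k x ∂μ = Λ k := fun k =>
    RealRMK.integral_rieszMeasure Λ' (CompactlySupportedContinuousMap.continuousMapEquiv k)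
  have : IsProbabilityMeasure μ := by
    have h := hμ 1
    rw [hΛ1] at h
    rw [isProbabilityMeasure_iff_real]
    simpa using h
  have : TopologicalSpace.SeparableSpace μ.support := hM μ
  obtain ⟨D, hDc, hD⟩ := TopologicalSpace.exists_countable_dense μ.support
  refine ⟨Subtype.val '' D, hDc.image _, fun g c hc hg => ?_⟩
  have hsupp : ∀ x ∈ μ.support, ‖g x‖ ≤ c := by
    have hcl : IsClosed {x : μ.support | ‖g x‖ ≤ c} := isClosed_le (by fun_prop) continuous_const
    have huniv : {x : μ.support | ‖g x‖ ≤ c} = univ :=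
      (hD.mono fun (x : μ.support) hx => hg x.1 ⟨x, hx, rfl⟩).closure_eq ▸ hcl.closure_eq.symm
    exact fun x hx => (huniv ▸ mem_univ _ : (⟨x, hx⟩ : μ.support) ∈ {x : μ.support | ‖g x‖ ≤ c})
  let k : C(K, ℝ) := ⟨fun x => ‖g x‖, by fun_prop⟩
  calc ‖ν g‖ ≤ Λ k := hνΛ g k fun x => le_rfl
    _ = ∫ x, k x ∂μ := (hμ k).symm
    _ ≤ ∫ _, c ∂μ := by
      refine integral_mono_ae ?_ (integrable_const c) ?_
      · exact k.continuous.integrable_of_hasCompactSupport (HasCompactSupport.of_compactSpace _)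
      · filter_upwards [μ.support_mem_ae_of_regular] with x hx using hsupp x hx
    _ = c := by simp

end Domination

/-- **Hahn–Banach theorem** for a functional bounded along a linear map: it factors through that
map by a functional of norm at most one. -/
theorem exists_strongDual_factor {𝕜 E F : Type*} [RCLike 𝕜] [AddCommGroup E] [Module 𝕜 E]
    [NormedAddCommGroup F] [NormedSpace 𝕜 F] (T : E →ₗ[𝕜] F) (ν : E →ₗ[𝕜] 𝕜)
    (h : ∀ g, ‖ν g‖ ≤ ‖T g‖) : ∃ ψ : StrongDual 𝕜 F, ‖ψ‖ ≤ 1 ∧ ∀ g, ψ (T g) = ν g := by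
  have hker : LinearMap.ker T ≤ LinearMap.ker ν := fun g hg => by
    simpa [LinearMap.mem_ker.1 hg] using h g
  let l : LinearMap.range T →ₗ[𝕜] 𝕜 :=
    (LinearMap.ker T).liftQ ν hker ∘ₗ T.quotKerEquivRange.symm.toLinearMap
  have hl : ∀ g, l ⟨T g, g, rfl⟩ = ν g := fun g => by
    have : T.quotKerEquivRange.symm ⟨T g, g, rfl⟩ = (LinearMap.ker T).mkQ g := by
      rw [LinearEquiv.symm_apply_eq]; rfl
    simp [l, this]
  have hbound : ∀ y, ‖l y‖ ≤ 1 * ‖y‖ := by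
    rintro ⟨_, g, rfl⟩
    rw [hl, one_mul]
    exact h g
  obtain ⟨ψ, hψ, hnorm⟩ := exists_extension_norm_eq _ (l.mkContinuous 1 hbound)
  refine ⟨ψ, hnorm.trans_le (l.mkContinuous_norm_le zero_le_one hbound), fun g => ?_⟩
  exact (hψ ⟨T g, g, rfl⟩).trans (hl g)

/-! ### Contractive projectional skeletons -/

/-- In a directed order in which increasing sequences are bounded above, every sequence is bounded
above. -/
theorem exists_forall_le_of_monotone_bddAbove {Γ : Type*} [PartialOrder Γ] [IsDirected Γ (· ≤ ·)]
    (h : ∀ s : ℕ → Γ, Monotone s → BddAbove (range s)) (a : ℕ → Γ) : ∃ t, ∀ n, a n ≤ t := by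
  choose u hu₁ hu₂ using fun x y : Γ => exists_ge_ge x y
  let b : ℕ → Γ := fun n => Nat.rec (a 0) (fun n x => u x (a (n + 1))) n
  have hab : ∀ n, a n ≤ b n := by
    rintro (_ | n)
    exacts [le_rfl, hu₂ _ _]
  obtain ⟨t, ht⟩ := h b (monotone_nat_of_le_succ fun n => hu₁ _ _)
  exact ⟨t, fun n => (hab n).trans (ht ⟨n, rfl⟩)⟩

/-- The family `P s` of projections of norm at most one, indexed by a nonempty up-directed
partially ordered set, has separable ranges and is compatible with the order and with suprema of
increasing sequences. The ranges need not cover `E`. -/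
structure IsContractiveProjectionalSkeleton {𝕜 E Γ : Type*} [RCLike 𝕜] [NormedAddCommGroup E]
    [NormedSpace 𝕜 E] [PartialOrder Γ] (P : Γ → E →L[𝕜] E) : Prop where
  index_nonempty : Nonempty Γ
  index_directed : IsDirected Γ (· ≤ ·)
  norm_le_one : ∀ s, ‖P s‖ ≤ 1
  isSeparable_range : ∀ s, TopologicalSpace.IsSeparable (range (P s))
  comp_of_le : ∀ s t, s ≤ t → ∀ x, P t (P s x) = P s x ∧ P s (P t x) = P s x
  exists_sup : ∀ s : ℕ → Γ, Monotone s →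
    ∃ t, IsLUB (range s) t ∧ ∀ x, Tendsto (fun n => P (s n) x) atTop (𝓝 (P t x))

/-- The adjoint of a continuous linear map, acting on weak* duals by precomposition. -/
noncomputable def WeakDual.precomp {𝕜 E F : Type*} [RCLike 𝕜] [NormedAddCommGroup E]
    [NormedSpace 𝕜 E] [NormedAddCommGroup F] [NormedSpace 𝕜 F] (T : E →L[𝕜] F)
    (φ : WeakDual 𝕜 F) : WeakDual 𝕜 E :=
  StrongDual.toWeakDual ((WeakDual.toStrongDual φ).comp T)

namespace WeakDual

variable {𝕜 E F : Type*} [RCLike 𝕜] [NormedAddCommGroup E] [NormedSpace 𝕜 E]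
  [NormedAddCommGroup F] [NormedSpace 𝕜 F]

theorem continuous_precomp (T : E →L[𝕜] F) : Continuous (precomp T) :=
  continuous_of_continuous_eval fun x => eval_continuous (T x)

theorem norm_precomp_le_one {T : E →L[𝕜] F} (hT : ‖T‖ ≤ 1) {φ : WeakDual 𝕜 F}
    (hφ : ‖toStrongDual φ‖ ≤ 1) : ‖toStrongDual (precomp T φ)‖ ≤ 1 :=
  (ContinuousLinearMap.opNorm_comp_le _ _).trans (mul_le_one₀ hφ (norm_nonneg _) hT)

theorem isCompact_norm_le_one : IsCompact {φ : WeakDual 𝕜 E | ‖toStrongDual φ‖ ≤ 1} := by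
  convert isCompact_closedBall (𝕜 := 𝕜) (0 : StrongDual 𝕜 E) 1 using 1
  ext φ
  simp

end WeakDual

section InvariantBall

variable {𝕜 E : Type*} [RCLike 𝕜] [NormedAddCommGroup E] [NormedSpace 𝕜 E] {Γ : Type*}

open WeakDual

/-- The functionals in the dual unit ball that are fixed by the adjoint of some member of the
family `P`. -/
def invariantBall (P : Γ → E →L[𝕜] E) : Set (WeakDual 𝕜 E) :=
  {φ | ‖toStrongDual φ‖ ≤ 1 ∧ ∃ s, precomp (P s) φ = φ}

theorem IsContractiveProjectionalSkeleton.precomp_comp_of_le [PartialOrder Γ] {P : Γ → E →L[𝕜] E}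
    (hP : IsContractiveProjectionalSkeleton P) {s t : Γ} (h : s ≤ t) (φ : WeakDual 𝕜 E) :
    precomp (P t) (precomp (P s) φ) = precomp (P s) φ ∧
      precomp (P s) (precomp (P t) φ) = precomp (P s) φ :=
  ⟨DFunLike.ext _ _ fun x => congrArg φ (hP.comp_of_le s t h x).2,
    DFunLike.ext _ _ fun x => congrArg φ (hP.comp_of_le s t h x).1⟩

theorem isCompact_fixedBall (T : E →L[𝕜] E) :
    IsCompact {φ : WeakDual 𝕜 E | ‖toStrongDual φ‖ ≤ 1 ∧ precomp T φ = φ} :=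
  isCompact_norm_le_one.inter_right (isClosed_eq (continuous_precomp T) continuous_id)

/-- Fixed functionals of the adjoint of `T` are determined by their values on the range of `T`. -/
theorem metrizableSpace_fixedBall {T : E →L[𝕜] E} (hT : TopologicalSpace.IsSeparable (range T)) :
    TopologicalSpace.MetrizableSpace
      {φ : WeakDual 𝕜 E | ‖toStrongDual φ‖ ≤ 1 ∧ precomp T φ = φ} := by
  obtain ⟨c, hc, hTc⟩ := hT
  have := hc.toEncodable
  have := isCompact_iff_compactSpace.1 (isCompact_fixedBall T)
  refine Metric.PiNatEmbed.TopologicalSpace.MetrizableSpace.of_countable_separating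
    (fun (x : c) (φ : {φ : WeakDual 𝕜 E | ‖toStrongDual φ‖ ≤ 1 ∧ precomp T φ = φ}) => φ.1 x)
    (fun x => (eval_continuous _).comp continuous_subtype_val) fun φ ψ hne => ?_
  by_contra! heq
  refine hne (Subtype.ext (DFunLike.ext _ _ fun x => ?_))
  have hcl : IsClosed {y | φ.1 y = ψ.1 y} :=
    isClosed_eq (toStrongDual φ.1).continuous (toStrongDual ψ.1).continuous
  have hx : φ.1 (T x) = ψ.1 (T x) :=
    hcl.closure_subset_iff.2 (fun y hy => heq ⟨y, hy⟩) (hTc ⟨x, rfl⟩)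
  calc φ.1 x = φ.1 (T x) := (DFunLike.congr_fun φ.2.2 x).symm
    _ = ψ.1 (T x) := hx
    _ = ψ.1 x := DFunLike.congr_fun ψ.2.2 x

/-- The adjoint projections form a full retractional skeleton in the invariant ball: it is
countably compact because countably many of its members are fixed by a common adjoint. -/
theorem IsContractiveProjectionalSkeleton.isNoncommCorson_invariantBall {𝕜 : Type}
    {E Γ : Type u} [RCLike 𝕜] [NormedAddCommGroup E] [NormedSpace 𝕜 E] [PartialOrder Γ]
    {P : Γ → E →L[𝕜] E} (hP : IsContractiveProjectionalSkeleton P) :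
    IsNoncommCorson (invariantBall P) := by
  have := hP.index_nonempty
  have := hP.index_directed
  have hemb : IsEmbedding (fun (φ : WeakDual 𝕜 E) x => φ x) :=
    DFunLike.coe_injective.isEmbedding_induced
  have := hemb.t35Space
  let R : Γ → invariantBall P → invariantBall P := fun s φ => ⟨precomp (P s) φ.1,
    norm_precomp_le_one (hP.norm_le_one s) φ.2.1, s, (hP.precomp_comp_of_le le_rfl φ.1).1⟩
  have hfix : ∀ {s} {φ : invariantBall P}, φ ∈ range (R s) ↔ precomp (P s) φ.1 = φ.1 := by
    refine fun {s φ} => ⟨?_, fun h => ⟨φ, Subtype.ext h⟩⟩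
    rintro ⟨ψ, rfl⟩
    exact (hP.precomp_comp_of_le le_rfl ψ.1).1
  have himage : ∀ s, Subtype.val '' range (R s) =
      {φ : WeakDual 𝕜 E | ‖toStrongDual φ‖ ≤ 1 ∧ precomp (P s) φ = φ} := by
    intro s
    ext φ
    refine ⟨?_, fun h => ⟨⟨φ, h.1, s, h.2⟩, hfix.2 h.2, rfl⟩⟩
    rintro ⟨ψ, hψ, rfl⟩
    exact ⟨ψ.2.1, hfix.1 hψ⟩
  have hcompact : ∀ s, IsCompact (range (R s)) := fun s => by
    rw [Subtype.isCompact_iff, himage]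
    exact isCompact_fixedBall _
  refine ⟨inferInstance, ⟨isCountablyCompact_iff_seq_clusterPt.2 fun φ _ => ?_⟩, Γ, inferInstance,
    R, ?_, ?_⟩
  · choose a ha using fun n => (φ n).2.2
    obtain ⟨t, ht⟩ := exists_forall_le_of_monotone_bddAbove (fun s hs =>
      let ⟨t, ht, _⟩ := hP.exists_sup s hs; ⟨t, ht.1⟩) a
    have hmem : ∀ n, φ n ∈ range (R t) := fun n => hfix.2 <| by
      rw [← ha n]
      exact (hP.precomp_comp_of_le (ht n) _).1
    -- The whole sequence lies in the compact range of `R t`.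
    obtain ⟨ψ, _, hψ⟩ := (hcompact t).isCountablyCompact.seq_clusterPt φ
      (Eventually.of_forall hmem)
    exact ⟨ψ, mem_univ _, hψ⟩
  · exact
      { index_nonempty := hP.index_nonempty
        index_directed := hP.index_directed
        continuous := fun s => ((continuous_precomp (P s)).comp continuous_subtype_val).subtype_mk _
        retraction := fun s => funext fun φ => Subtype.ext (hP.precomp_comp_of_le le_rfl φ.1).1
        isCompact_range := hcompact
        metrizable_range := fun s => by
          have := metrizableSpace_fixedBall (hP.isSeparable_range s)
          rw [← himage] at this
          exact (IsEmbedding.subtypeVal.homeomorphImage (range (R s))).isEmbedding.metrizableSpace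
        comp_of_le := fun s t h => ⟨funext fun φ => Subtype.ext (hP.precomp_comp_of_le h φ.1).1.symm,
          funext fun φ => Subtype.ext (hP.precomp_comp_of_le h φ.1).2.symm⟩
        exists_sup := fun s hs => by
          obtain ⟨t, ht, hlim⟩ := hP.exists_sup s hs
          refine ⟨t, ht, fun φ => tendsto_subtype_rng.2 ?_⟩
          rw [tendsto_iff_forall_eval_tendsto_topDualPairing]
          exact fun x => ((toStrongDual φ.1).continuous.tendsto _).comp (hlim x)
        tendsto_self := fun φ => by
          -- The net is eventually constant, since `φ` is fixed from some index on.
          obtain ⟨s, hs⟩ := φ.2.2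
          refine tendsto_const_nhds.congr' ((eventually_ge_atTop s).mono fun t ht => ?_)
          refine Subtype.ext ?_
          change φ.1 = precomp (P t) φ.1
          rw [← hs]
          exact (hP.precomp_comp_of_le ht φ.1).1.symm }
  · exact eq_univ_of_forall fun φ => let ⟨s, hs⟩ := φ.2.2; mem_iUnion.2 ⟨s, hfix.2 hs⟩

end InvariantBall

/-! ### The projectional skeleton induced by a retractional skeleton -/

section Composition

variable {Y Γ : Type*} [TopologicalSpace Y] [PartialOrder Γ] {r : Γ → Y → Y}

/-- Along an increasing sequence of indices, the pointwise convergence of the retractions improves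
to uniform convergence after composition with a bounded continuous function. If the convergence
failed along points `y n`, then limits `a` of `r t (y n)` and `b` of `r (s n) (y n)` along an
ultrafilter would have the same image under each `r (s m)`, hence be equal. -/
theorem IsRetractionalSkeleton.tendsto_compContinuous [T2Space Y] {β : Type*} [PseudoMetricSpace β]
    (hr : IsRetractionalSkeleton r) {s : ℕ → Γ} (hs : Monotone s) {t : Γ} (hst : ∀ n, s n ≤ t)
    (hlim : ∀ x, Tendsto (fun n => r (s n) x) atTop (𝓝 (r t x))) (g : Y →ᵇ β) :
    Tendsto (fun n => g.compContinuous ⟨r (s n), hr.continuous _⟩) atTop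
      (𝓝 (g.compContinuous ⟨r t, hr.continuous t⟩)) := by
  rw [Metric.tendsto_nhds]
  by_contra! hcon
  obtain ⟨ε, hε, hfreq⟩ := hcon
  let bad : Set ℕ := {n | ∃ y, ε / 2 < dist (g (r (s n) y)) (g (r t y))}
  have hbad : ∃ᶠ n in atTop, n ∈ bad := by
    refine hfreq.mono fun n hn => ?_
    by_contra! hle
    refine hn.not_gt (lt_of_le_of_lt ?_ (half_lt_self hε))
    exact (BoundedContinuousFunction.dist_le (half_pos hε).le).2 fun y =>
      not_lt.1 fun h => hle ⟨y, h⟩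
  have : (atTop ⊓ 𝓟 bad : Filter ℕ).NeBot := frequently_mem_iff_neBot.1 hbad
  let U := Ultrafilter.of (atTop ⊓ 𝓟 bad)
  have hU : (U : Filter ℕ) ≤ atTop ⊓ 𝓟 bad := Ultrafilter.of_le _
  have hUtop : (U : Filter ℕ) ≤ atTop := hU.trans inf_le_left
  have hUbad : ∀ᶠ n in (U : Filter ℕ), n ∈ bad := le_principal_iff.1 (hU.trans inf_le_right)
  obtain ⟨n₀, hn₀⟩ := hUbad.exists
  have : Nonempty Y := ⟨hn₀.choose⟩
  have hex : ∀ n, ∃ y, n ∈ bad → ε / 2 < dist (g (r (s n) y)) (g (r t y)) := fun n => by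
    by_cases hn : n ∈ bad
    · exact ⟨hn.choose, fun _ => hn.choose_spec⟩
    · exact ⟨Classical.arbitrary Y, fun h => absurd h hn⟩
  choose y hy using hex
  have hlimit : ∀ z : ℕ → Y, (∀ n, z n ∈ range (r t)) →
      ∃ a ∈ range (r t), Tendsto z (U : Filter ℕ) (𝓝 a) := fun z hz =>
    (hr.isCompact_range t).ultrafilter_le_nhds' (U.map z) (Ultrafilter.mem_map.2 (univ_mem' hz))
  obtain ⟨a, ha, hya⟩ := hlimit (fun n => r t (y n)) fun n => ⟨_, rfl⟩
  obtain ⟨b, hb, hyb⟩ := hlimit (fun n => r (s n) (y n)) fun n =>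
    ⟨r (s n) (y n), (congrFun (hr.comp_of_le _ _ (hst n)).1 _).symm⟩
  have hab : ∀ m, r (s m) a = r (s m) b := fun m => by
    have h1 := ((hr.continuous (s m)).tendsto a).comp hya
    have h2 := ((hr.continuous (s m)).tendsto b).comp hyb
    refine tendsto_nhds_unique h1 (h2.congr' (hUtop ((eventually_ge_atTop m).mono fun n hn => ?_)))
    calc r (s m) (r (s n) (y n)) = r (s m) (y n) :=
          (congrFun (hr.comp_of_le _ _ (hs hn)).2 _).symm
      _ = r (s m) (r t (y n)) := congrFun (hr.comp_of_le _ _ (hst m)).2 _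
  have heq : a = b := by
    have hfix : ∀ z ∈ range (r t), r t z = z := by
      rintro _ ⟨w, rfl⟩
      exact congrFun (hr.retraction t) w
    rw [← hfix a ha, ← hfix b hb]
    exact tendsto_nhds_unique (hlim a) ((hlim b).congr fun m => (hab m).symm)
  subst heq
  have hdist := ((g.continuous.tendsto a).comp hyb).dist ((g.continuous.tendsto a).comp hya)
  rw [dist_self] at hdist
  obtain ⟨n, hn, hn'⟩ := ((hdist.eventually_lt_const (half_pos hε)).and hUbad).exists
  exact lt_asymm hn (hy n hn')

/-- Composition with a map whose range is compact metrizable has separable range. -/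
theorem isSeparable_range_compContinuous {X 𝕜 : Type*} [TopologicalSpace X]
    [NormedField 𝕜] [SecondCountableTopology 𝕜] (ρ : C(X, X)) (hc : IsCompact (range ρ))
    (hm : TopologicalSpace.MetrizableSpace (range ρ)) :
    TopologicalSpace.IsSeparable (range fun g : X →ᵇ 𝕜 => g.compContinuous ρ) := by
  have := isCompact_iff_compactSpace.1 hc
  let := TopologicalSpace.metrizableSpaceMetric (range ρ)
  let ρ' : C(X, range ρ) := ⟨rangeFactorization ρ, by fun_prop⟩
  let Φ : C(range ρ, 𝕜) → (X →ᵇ 𝕜) := fun h =>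
    (BoundedContinuousFunction.mkOfCompact h).compContinuous ρ'
  have hΦ : Continuous Φ := (BoundedContinuousFunction.continuous_compContinuous ρ').comp
    (ContinuousMap.isometryEquivBoundedOfCompact _ _).continuous
  refine (TopologicalSpace.isSeparable_range hΦ).mono ?_
  rintro _ ⟨g, rfl⟩
  exact ⟨g.toContinuousMap.restrict _, rfl⟩

theorem IsRetractionalSkeleton.isContractiveProjectionalSkeleton [T2Space Y] (𝕜 : Type*) [RCLike 𝕜]
    (hr : IsRetractionalSkeleton r) :
    IsContractiveProjectionalSkeleton fun s =>
      BoundedContinuousFunction.compContinuousCLM 𝕜 𝕜 (⟨r s, hr.continuous s⟩ : C(Y, Y)) where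
  index_nonempty := hr.index_nonempty
  index_directed := hr.index_directed
  norm_le_one _ := LinearMap.mkContinuous_norm_le _ zero_le_one _
  isSeparable_range s := isSeparable_range_compContinuous ⟨r s, hr.continuous s⟩
    (hr.isCompact_range s) (hr.metrizable_range s)
  comp_of_le s t h g :=
    ⟨DFunLike.ext _ _ fun y => congrArg g (congrFun (hr.comp_of_le s t h).2 y).symm,
      DFunLike.ext _ _ fun y => congrArg g (congrFun (hr.comp_of_le s t h).1 y).symm⟩
  exists_sup s hs :=
    let ⟨t, ht, hlim⟩ := hr.exists_sup s hs
    ⟨t, ht, hr.tendsto_compContinuous hs (fun n => ht.1 ⟨n, rfl⟩) hlim⟩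

end Composition

/-! ### The dual unit ball -/

/-- Restriction of functionals along `f : Y → K` maps the invariant ball onto the dual unit ball of
`C(K, 𝕜)`: a functional on `C(K, 𝕜)` is controlled by a countable set, hence by the image of the
range of a single retraction `r s`, and so factors through `g ↦ g ∘ f ∘ r s`. -/
theorem isWeaklyNoncommCorsonCompact_dualUnitBall (𝕜 : Type) [RCLike 𝕜] {K : Type u}
    [TopologicalSpace K] [CompactSpace K] [T2Space K]
    (hK : IsWeaklyNoncommCorsonCompact K) (hM : HasPropertyM K) :
    IsWeaklyNoncommCorsonCompact (dualUnitBall 𝕜 K) := by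
  have hball : CompactSpace (dualUnitBall 𝕜 K) :=
    isCompact_iff_compactSpace.1 WeakDual.isCompact_norm_le_one
  obtain ⟨Y, _, hY, f, hf, hsurj⟩ := hK.2.exists_surjection
  have := hY.t35
  obtain ⟨Γ, _, r, hr, hfull⟩ := hY.exists_full_skeleton
  have := hr.index_directed
  have hP := hr.isContractiveProjectionalSkeleton 𝕜
  let P := fun s =>
    BoundedContinuousFunction.compContinuousCLM 𝕜 𝕜 (⟨r s, hr.continuous s⟩ : C(Y, Y))
  let T : C(K, 𝕜) →L[𝕜] Y →ᵇ 𝕜 :=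
    BoundedContinuousFunction.compContinuousCLM 𝕜 𝕜 (⟨f, hf⟩ : C(Y, K)) ∘L
      (ContinuousMap.linearIsometryBoundedOfCompact K 𝕜 𝕜).toContinuousLinearEquiv
  have hTapply : ∀ g y, T g y = g (f y) := fun _ _ => rfl
  have hT : ‖T‖ ≤ 1 := T.opNorm_le_bound zero_le_one fun g => by
    rw [one_mul, BoundedContinuousFunction.norm_le (norm_nonneg _)]
    exact fun y => g.norm_coe_le_norm (f y)
  refine ⟨hball, inferInstance, inferInstance, invariantBall P, inferInstance,
    hP.isNoncommCorson_invariantBall,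
    fun φ => ⟨WeakDual.precomp T φ.1, WeakDual.norm_precomp_le_one hT φ.2.1⟩,
    ((WeakDual.continuous_precomp T).comp continuous_subtype_val).subtype_mk _, ?_⟩
  rintro ⟨ν, hν⟩
  obtain ⟨C, hC, hCν⟩ := hM.exists_countable_norm_le (WeakDual.toStrongDual ν) hν
  obtain ⟨s, hs⟩ : ∃ s, ∀ x ∈ C, ∃ y, f (r s y) = x := by
    rcases C.eq_empty_or_nonempty with rfl | hne
    · exact ⟨hr.index_nonempty.some, by simp⟩
    obtain ⟨x, rfl⟩ := hC.exists_eq_range hne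
    choose y hy using fun n => hsurj (x n)
    choose a ha using fun n => mem_iUnion.1 (hfull ▸ mem_univ (y n) : y n ∈ inducedSet r)
    obtain ⟨t, ht⟩ := exists_forall_le_of_monotone_bddAbove (fun s hs =>
      let ⟨t, ht, _⟩ := hr.exists_sup s hs; ⟨t, ht.1⟩) a
    refine ⟨t, ?_⟩
    rintro _ ⟨n, rfl⟩
    obtain ⟨z, hz⟩ := ha n
    refine ⟨y n, ?_⟩
    rw [← hy n, ← hz]
    exact congrArg f (congrFun (hr.comp_of_le _ _ (ht n)).1 z).symm
  obtain ⟨ψ, hψ, hψT⟩ := exists_strongDual_factor ((P s ∘L T).toLinearMap)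
    (WeakDual.toStrongDual ν).toLinearMap fun g => hCν g _ (norm_nonneg _) fun x hx => by
      obtain ⟨y, rfl⟩ := hs x hx
      exact (P s (T g)).norm_coe_le_norm y
  refine ⟨⟨WeakDual.precomp (P s) (StrongDual.toWeakDual ψ),
    WeakDual.norm_precomp_le_one (hP.norm_le_one s) hψ, s,
    (hP.precomp_comp_of_le le_rfl _).1⟩, Subtype.ext (DFunLike.ext _ _ hψT)⟩

theorem mainTheorem6 (K : Type u) [TopologicalSpace K] [CompactSpace K] [T2Space K]
    (hK : IsWeaklyNoncommCorsonCompact K) (hM : HasPropertyM K) :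
    IsWeaklyNoncommCorsonCompact (dualUnitBall ℝ K) ∧
      IsWeaklyNoncommCorsonCompact (dualUnitBall ℂ K) :=
  ⟨isWeaklyNoncommCorsonCompact_dualUnitBall ℝ hK hM,
    isWeaklyNoncommCorsonCompact_dualUnitBall ℂ hK hM⟩
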